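/- Let $R_0>R>0$, let $p\ge 2$ be an integer and let $C\in\mathbb R\setminus\{0\}$. Let $(a_n)_{n\ge 2}$ be the sequence with a single nonzero term given by $$a_p = C\,\frac{p!}{R^p},\qquad a_n = 0 \ \text{ for } n\ge 2,\ n\neq p .$$ Put $$\phi(z)=\sum_{n\ge 2} a_n\frac{z^{n-1}}{(n-1)!}\quad(|z|<R_0),\qquad G(x)=\int_0^R \phi(t)\,e^{-t/x}\,dt\quad (x>0).$$ Then there is no pair $(\hat C,\hat R)$ with $\hat C>0$ and $\hat R>R$ such that $$|G^{(n)}(x)|\le \hat C\,(n!)^2\left(\frac{2}{\hat R}\right)^n\qquad\text{for all } n\in\mathbb N=\{0,1,2,\dots\}\text{ and all } x\in(0,R).$$ -/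

import Mathlib

open scoped Nat

/-- The function `φ(z) = ∑_{n ≥ 2} a_n z^(n-1) / (n-1)!` attached to a sequence `(a_n)_{n ≥ 2}` of
complex numbers. Only the values `a n` with `2 ≤ n` are used. -/
noncomputable def borelPhi (a : ℕ → ℂ) (z : ℂ) : ℂ :=
  ∑' n : {n : ℕ // 2 ≤ n}, a n * z ^ ((n : ℕ) - 1) / (((n : ℕ) - 1)! : ℂ)

/-- The truncated Laplace transform `G(x) = ∫_0^R φ(t) exp(-t/x) dt`, considered for `x > 0`. -/
noncomputable def truncLaplace (a : ℕ → ℂ) (R : ℝ) (x : ℝ) : ℂ :=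
  ∫ t in (0 : ℝ)..R, borelPhi a (t : ℂ) * (Real.exp (-t / x) : ℂ)

/-! With a single coefficient, `G` is a constant times `x ^ p` times a lower incomplete Gamma
function of `R / x`. Hence it solves `x G' - p G = const * exp (-R / x)` with a nonzero constant.
Differentiating `n` times, a bound on all `G^(n)` with some `Rhat > R` passes to the derivatives of
`exp (-R / x)` on `(0, R)`, at the cost of a factor `O(n ^ 2)`.

Such a bound is impossible. On the line `Re s = 1` the Mellin transform of the `n`-th derivative is
at most its `L¹` norm, that is, `R` times the supremum on `(0, R)` plus a tail `O(n! (2 / R) ^ n)`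
(`norm_mellin_iteratedDeriv_expNegDiv_le`). Integration by parts gives its modulus exactly through
Gamma. At `s = 1 - n i` it is at least `(n!) ^ 2 (2 / R) ^ n` up to a power of `n`
(`le_norm_mellin_iteratedDeriv_expNegDiv`). The height `n` is the best to leading exponential order:
at height `τ n` the exponent is stationary when `2 arctan (1 / τ) = π / 2`, so `τ = 1`. -/

section

/-! ### Derivatives of `exp (-R / x)` and their Mellin transforms. -/

open Complex Set Filter Topology MeasureTheory Asymptotics

/-- The holomorphic function `exp (-R / z)` on the punctured plane. -/
noncomputable def expNegDiv (R : ℝ) (z : ℂ) : ℂ := exp (-R / z)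

theorem differentiableOn_expNegDiv (R : ℝ) : DifferentiableOn ℂ (expNegDiv R) {0}ᶜ := by
  intro z hz
  unfold expNegDiv
  have : z ≠ 0 := hz
  exact (((differentiableAt_const _).div differentiableAt_id this).cexp).differentiableWithinAt

/-- On this disc `Re z ≥ x / 2` and `‖z‖ ≤ 3 x / 2`, so `Re (R / z) ≥ 2 R / (9 x)`; then `exp (-y) ≤
m! / y ^ m`. The free `m` serves both ends: `m = 0` at infinity, large `m` for flatness at `0`. -/
theorem norm_expNegDiv_le {R : ℝ} (hR : 0 < R) (m : ℕ) {x : ℝ} (hx : 0 < x) {z : ℂ}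
    (hz : ‖z - x‖ ≤ x / 2) : ‖expNegDiv R z‖ ≤ m ! * (9 * x / (2 * R)) ^ m := by
  have hre : x / 2 ≤ z.re := by
    have := (abs_le.1 ((abs_re_le_norm (z - x)).trans hz)).1
    simp at this
    linarith
  have hn : ‖z‖ ≤ 3 * x / 2 := by
    have := norm_add_le (z - x) x
    simp [abs_of_pos hx] at this
    linarith
  have hz0 : 0 < ‖z‖ := by
    have := abs_re_le_norm z
    have := le_abs_self z.re
    linarith
  have hsq : normSq z = ‖z‖ ^ 2 := normSq_eq_norm_sq z
  have key : (-R / z : ℂ).re ≤ -(2 * R / (9 * x)) := by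
    have : (-R / z : ℂ).re = -(R * z.re / ‖z‖ ^ 2) := by
      simp [div_re, hsq]
      ring
    rw [this, neg_le_neg_iff, div_le_div_iff₀ (by positivity) (by positivity)]
    have h1 : ‖z‖ ^ 2 ≤ (3 * x / 2) ^ 2 := by gcongr
    have h2 : 2 * R * ‖z‖ ^ 2 ≤ 2 * R * (3 * x / 2) ^ 2 := by gcongr
    have h3 : R * (x / 2) * (9 * x) ≤ R * z.re * (9 * x) := by gcongr
    nlinarith
  rw [expNegDiv, norm_exp]
  refine (Real.exp_le_exp.2 key).trans ?_
  have h := Real.pow_div_factorial_le_exp (x := 2 * R / (9 * x)) (by positivity) m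
  have hm : (0 : ℝ) < m ! := by positivity
  rw [Real.exp_neg, inv_le_comm₀ (Real.exp_pos _) (by positivity)]
  refine le_trans (le_of_eq ?_) h
  rw [mul_inv, ← inv_pow, inv_div]
  ring

theorem norm_iteratedDeriv_expNegDiv_le {R : ℝ} (hR : 0 < R) (k m : ℕ) {x : ℝ} (hx : 0 < x) :
    ‖iteratedDeriv k (expNegDiv R) x‖ ≤ k ! * (m ! * (9 * x / (2 * R)) ^ m) / (x / 2) ^ k := by
  refine norm_iteratedDeriv_le_of_forall_mem_sphere_norm_le k (by positivity) ?_ ?_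
  · refine DifferentiableOn.diffContOnCl_ball (U := {0}ᶜ) (differentiableOn_expNegDiv R) ?_
    intro z hz hz0
    rw [mem_singleton_iff.1 hz0] at hz
    simp [abs_of_pos hx] at hz
    linarith
  · intro z hz
    exact norm_expNegDiv_le hR m hx (by rw [← mem_sphere_iff_norm.1 hz])

theorem hasDerivAt_iteratedDeriv_expNegDiv (R : ℝ) (k : ℕ) {x : ℝ} (hx : 0 < x) :
    HasDerivAt (fun y : ℝ => iteratedDeriv k (expNegDiv R) y)
      (iteratedDeriv (k + 1) (expNegDiv R) x) x := by
  have hx0 : (x : ℂ) ≠ 0 := by exact_mod_cast hx.ne'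
  have han : AnalyticAt ℂ (expNegDiv R) x :=
    (differentiableOn_expNegDiv R).analyticAt (isOpen_compl_singleton.mem_nhds hx0)
  have h : HasDerivAt (iteratedDeriv k (expNegDiv R))
      (iteratedDeriv (k + 1) (expNegDiv R) x) x := by
    rw [iteratedDeriv_succ]
    rw [iteratedDeriv_eq_iterate]
    exact (han.iterated_deriv k).differentiableAt.hasDerivAt
  exact h.comp_ofReal

theorem continuousOn_iteratedDeriv_expNegDiv (R : ℝ) (k : ℕ) :
    ContinuousOn (fun y : ℝ => iteratedDeriv k (expNegDiv R) y) (Ioi 0) :=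
  fun _ hx => (hasDerivAt_iteratedDeriv_expNegDiv R k hx).continuousAt.continuousWithinAt

theorem iteratedDeriv_expNegDiv_isBigO {R : ℝ} (hR : 0 < R) (k m : ℕ) {l : Filter ℝ}
    (hl : ∀ᶠ x in l, 0 < x) :
    (fun y : ℝ => iteratedDeriv k (expNegDiv R) y) =O[l] fun x : ℝ => x ^ (-((k : ℝ) - m)) := by
  refine IsBigO.of_bound (k ! * (m ! * (9 / (2 * R)) ^ m) * 2 ^ k) ?_
  filter_upwards [hl] with x hx
  refine (norm_iteratedDeriv_expNegDiv_le hR k m hx).trans (le_of_eq ?_)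
  rw [neg_sub, Real.rpow_sub hx, Real.rpow_natCast, Real.rpow_natCast, Real.norm_eq_abs,
    abs_of_pos (by positivity)]
  simp only [div_pow, mul_pow]
  field_simp

theorem mellinConvergent_iteratedDeriv_expNegDiv {R : ℝ} (hR : 0 < R) (k : ℕ) {w : ℂ}
    (hw : w.re < k) :
    MellinConvergent (fun y : ℝ => iteratedDeriv k (expNegDiv R) y) w := by
  obtain ⟨m, hm⟩ := exists_nat_gt ((k : ℝ) - w.re)
  refine mellinConvergent_of_isBigO_rpow (a := k) (b := (k : ℝ) - m)
    ((continuousOn_iteratedDeriv_expNegDiv R k).locallyIntegrableOn measurableSet_Ioi) ?_ hw ?_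
    (by linarith)
  · simpa using iteratedDeriv_expNegDiv_isBigO hR k 0 (eventually_gt_atTop 0)
  · exact iteratedDeriv_expNegDiv_isBigO hR k m self_mem_nhdsWithin

theorem tendsto_cpow_mul_zero_of_isBigO {f : ℝ → ℂ} {a : ℝ} {w : ℂ} {l : Filter ℝ}
    (hl : ∀ᶠ x in l, 0 < x) (hf : f =O[l] fun x : ℝ => x ^ a)
    (h : Tendsto (fun x : ℝ => x ^ (w.re + a)) l (𝓝 0)) :
    Tendsto (fun x : ℝ => (x : ℂ) ^ w * f x) l (𝓝 0) := by
  have h1 : (fun x : ℝ => (x : ℂ) ^ w) =O[l] fun x : ℝ => x ^ w.re := by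
    refine IsBigO.of_bound 1 ?_
    filter_upwards [hl] with x hx
    rw [norm_cpow_eq_rpow_re_of_pos hx, Real.norm_eq_abs, abs_of_pos (by positivity), one_mul]
  refine (h1.mul hf).trans_tendsto (h.congr' ?_)
  filter_upwards [hl] with x hx
  exact Real.rpow_add hx _ _

/-- Integration by parts; `w.re < k` kills the boundary term at infinity, flatness the one at `0`.
-/
theorem mellin_iteratedDeriv_succ_expNegDiv {R : ℝ} (hR : 0 < R) (k : ℕ) {w : ℂ} (hw : w.re < k) :
    mellin (fun y : ℝ => iteratedDeriv (k + 1) (expNegDiv R) y) (w + 1) =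
      -w * mellin (fun y : ℝ => iteratedDeriv k (expNegDiv R) y) w := by
  have hc := mellinConvergent_iteratedDeriv_expNegDiv hR k hw
  have hc' := mellinConvergent_iteratedDeriv_expNegDiv hR (k + 1) (w := w + 1) (by simpa using hw)
  simp only [MellinConvergent, add_sub_cancel_right, smul_eq_mul] at hc hc'
  simp only [mellin, add_sub_cancel_right, smul_eq_mul]
  obtain ⟨m, hm⟩ := exists_nat_gt ((k : ℝ) - w.re)
  have h0 : Tendsto (fun x : ℝ => (x : ℂ) ^ w * iteratedDeriv k (expNegDiv R) x) (𝓝[>] 0) (𝓝 0) := by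
    refine tendsto_cpow_mul_zero_of_isBigO self_mem_nhdsWithin
      (iteratedDeriv_expNegDiv_isBigO hR k m self_mem_nhdsWithin) ?_
    have hp : 0 < w.re + -((k : ℝ) - m) := by linarith
    have := (Real.continuousAt_rpow_const 0 _ (Or.inr hp.le)).tendsto
    rw [Real.zero_rpow hp.ne'] at this
    exact this.mono_left nhdsWithin_le_nhds
  have hinf : Tendsto (fun x : ℝ => (x : ℂ) ^ w * iteratedDeriv k (expNegDiv R) x) atTop (𝓝 0) := by
    refine tendsto_cpow_mul_zero_of_isBigO (eventually_gt_atTop 0)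
      (iteratedDeriv_expNegDiv_isBigO hR k 0 (eventually_gt_atTop 0)) ?_
    have hp : 0 < (k : ℝ) - w.re := by linarith
    refine (tendsto_rpow_neg_atTop hp).congr fun x => ?_
    congr 1
    push_cast
    ring
  have key := integral_Ioi_mul_deriv_eq_deriv_mul (a := 0)
    (u := fun x : ℝ => (x : ℂ) ^ w) (u' := fun x : ℝ => w * (x : ℂ) ^ (w - 1))
    (v := fun x : ℝ => iteratedDeriv k (expNegDiv R) x)
    (v' := fun x : ℝ => iteratedDeriv (k + 1) (expNegDiv R) x) (a' := 0) (b' := 0)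
    (fun x hx => by
      have h := (hasDerivAt_id (x : ℂ)).cpow_const (c := w) (ofReal_mem_slitPlane.2 hx)
      simpa using h.comp_ofReal)
    (fun x hx => hasDerivAt_iteratedDeriv_expNegDiv R k hx) hc'
    (IntegrableOn.congr_fun (hc.const_mul w) (fun x _ => by simp [mul_assoc]) measurableSet_Ioi) h0 hinf
  rw [key, sub_self, zero_sub, neg_mul, ← integral_const_mul]
  simp only [mul_assoc]

theorem mellin_expNegDiv {R : ℝ} (hR : 0 < R) {w : ℂ} (hw : w.re < 0) :
    mellin (fun y : ℝ => expNegDiv R y) w = (1 / R : ℂ) ^ (-w) * Gamma (-w) := by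
  have h := mellin_comp_inv (fun t : ℝ => exp (-(R * t : ℂ))) w
  have h2 : (fun t : ℝ => exp (-(R * ((t⁻¹ : ℝ) : ℂ)))) = fun y : ℝ => expNegDiv R y := by
    ext t
    simp [expNegDiv, div_eq_mul_inv]
  rw [h2] at h
  rw [h, ← integral_cpow_mul_exp_neg_mul_Ioi (by simpa using hw) hR]
  rfl

theorem norm_mellin_iteratedDeriv_expNegDiv {R : ℝ} (hR : 0 < R) {w : ℂ} (hw : w.re < 0) (k : ℕ) :
    ‖mellin (fun y : ℝ => iteratedDeriv k (expNegDiv R) y) (w + k)‖ =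
      (∏ j ∈ Finset.range k, ‖w + j‖) * (R ^ w.re * ‖Gamma (-w)‖) := by
  induction k with
  | zero =>
    have : ((1 / R : ℝ) : ℂ) = (1 / R : ℂ) := by push_cast; rfl
    simp only [iteratedDeriv_zero, Nat.cast_zero, add_zero, mellin_expNegDiv hR hw,
      Finset.range_zero, Finset.prod_empty, one_mul]
    rw [norm_mul, ← this, norm_cpow_eq_rpow_re_of_pos (by positivity), one_div,
      Real.inv_rpow hR.le, neg_re, Real.rpow_neg hR.le, inv_inv]
  | succ k ih =>
    have := mellin_iteratedDeriv_succ_expNegDiv hR k (w := w + k) (by simpa using hw)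
    rw [Nat.cast_succ, ← add_assoc, this, norm_mul, norm_neg, ih, Finset.prod_range_succ]
    ring

end

/-! ### Explicit estimates for products, factorials and Gamma. -/

section

open Real Finset

theorem integral_log_sq_add_sq {c : ℝ} (hc : 0 < c) :
    ∫ x in (0 : ℝ)..c, log (c ^ 2 + x ^ 2) = c * log (2 * c ^ 2) - 2 * c + c * π / 2 := by
  have hpos : ∀ x : ℝ, 0 < c ^ 2 + x ^ 2 := fun x => by positivity
  have hd : ∀ x ∈ Set.uIcc (0 : ℝ) c, HasDerivAt
      (fun x => x * log (c ^ 2 + x ^ 2) - 2 * x + 2 * c * arctan (x / c))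
      (log (c ^ 2 + x ^ 2)) x := by
    intro x _
    have h1 : HasDerivAt (fun x : ℝ => c ^ 2 + x ^ 2) (2 * x) x := by
      simpa using (hasDerivAt_pow 2 x).const_add (c ^ 2)
    have h2 := ((hasDerivAt_id x).mul (h1.log (hpos x).ne')).sub ((hasDerivAt_id x).const_mul 2)
    have h3 := (((hasDerivAt_id x).div_const c).arctan).const_mul (2 * c)
    refine (h2.add h3).congr_deriv ?_
    have := (hpos x).ne'
    have h4 : (1 + (x / c) ^ 2) = (c ^ 2 + x ^ 2) / c ^ 2 := by field_simp
    simp only [id, h4]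
    field_simp
    ring
  rw [intervalIntegral.integral_eq_sub_of_hasDerivAt hd]
  · have : c ^ 2 + c ^ 2 = 2 * c ^ 2 := by ring
    simp only [div_self hc.ne', arctan_one, zero_div, arctan_zero, this]
    ring
  · exact (Continuous.log (by fun_prop) fun x => (hpos x).ne').intervalIntegrable _ _

/-- Comparison of a Riemann sum of `log (1 + x²)` with its integral, in multiplicative form. -/
theorem le_prod_sq_add_sq {n : ℕ} (hn : 0 < n) :
    (2 * (n : ℝ) ^ 2) ^ n * exp (-2 * n + n * π / 2) ≤ 2 * ∏ j ∈ range n, ((n : ℝ) ^ 2 + j ^ 2) := by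
  have hn' : (0 : ℝ) < n := by exact_mod_cast hn
  have hpos : ∀ x : ℝ, 0 < (n : ℝ) ^ 2 + x ^ 2 := fun x => by positivity
  have hmono : MonotoneOn (fun x : ℝ => log ((n : ℝ) ^ 2 + x ^ 2)) (Set.Icc 0 (0 + n)) := by
    intro x hx y _ hxy
    have := hx.1
    exact log_le_log (hpos x) (by gcongr)
  have h := hmono.integral_le_sum
  simp only [zero_add] at h
  rw [integral_log_sq_add_sq hn'] at h
  have hP : 0 < ∏ j ∈ range n, ((n : ℝ) ^ 2 + (j : ℝ) ^ 2) := prod_pos fun i _ => hpos i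
  -- The right-endpoint sum has the term `j = n` in place of `j = 0`; their ratio `2 n ^ 2 / n ^ 2`
  -- is the factor `2`.
  have hsum : ∑ i ∈ range n, log ((n : ℝ) ^ 2 + ((i + 1 : ℕ) : ℝ) ^ 2) =
      log (2 * ∏ j ∈ range n, ((n : ℝ) ^ 2 + j ^ 2)) := by
    have h1 := sum_range_succ (fun i : ℕ => log ((n : ℝ) ^ 2 + (i : ℝ) ^ 2)) n
    rw [sum_range_succ'] at h1
    have h2 : log ((n : ℝ) ^ 2 + (n : ℝ) ^ 2) =
        log 2 + log ((n : ℝ) ^ 2 + ((0 : ℕ) : ℝ) ^ 2) := by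
      rw [← log_mul (by norm_num) (by positivity)]
      congr 1
      push_cast
      ring
    rw [log_mul two_ne_zero hP.ne', log_prod (fun (i : ℕ) _ => (hpos i).ne')]
    linarith
  rw [hsum] at h
  rw [← log_le_log_iff (by positivity) (by positivity), log_mul (by positivity) (by positivity),
    log_exp, log_pow]
  linarith

theorem factorial_le_mul_pow_div_exp {n : ℕ} (hn : 0 < n) :
    (n ! : ℝ) ≤ exp 1 * n * (n ^ n * exp (-n)) := by
  induction n, hn using Nat.le_induction with
  | base => simp [← exp_add]
  | succ n hn ih =>
    have hn' : (0 : ℝ) < n := by exact_mod_cast hn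
    have h1 : exp 1 * (n : ℝ) ^ (n + 1) ≤ ((n : ℝ) + 1) ^ (n + 1) := by
      have h : (1 : ℝ) ≤ (n + 1) * log ((n + 1) / n) := by
        have := one_sub_inv_le_log_of_pos (x := ((n : ℝ) + 1) / n) (by positivity)
        rw [inv_div] at this
        calc (1 : ℝ) = (n + 1) * (1 - n / (n + 1)) := by field_simp; ring
          _ ≤ _ := by gcongr
      rw [← log_le_log_iff (by positivity) (by positivity), log_mul (by positivity) (by positivity),
        log_exp, log_pow, log_pow]
      rw [log_div (by positivity) (by positivity)] at h
      push_cast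
      linarith
    rw [Nat.factorial_succ]
    push_cast
    have h2 : exp 1 * exp (-((n : ℝ) + 1)) = exp (-n) := by rw [← exp_add]; ring_nf
    calc ((n : ℝ) + 1) * n ! ≤ (n + 1) * (exp 1 * n * (n ^ n * exp (-n))) := by gcongr
      _ = (n + 1) * (exp 1 * n ^ (n + 1)) * exp (-n) := by ring
      _ ≤ (n + 1) * (n + 1) ^ (n + 1) * exp (-n) := by gcongr
      _ = _ := by rw [← h2]; ring

/-- The reflection formula gives `|Γ(1 + i t)| ^ 2 = π t / sinh (π t)`, and `sinh y ≤ exp y / 2`. -/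
theorem sq_norm_Gamma_one_add_mul_I {t : ℝ} (ht : 0 < t) :
    2 * π * t * exp (-(π * t)) ≤ ‖Complex.Gamma (1 + t * Complex.I)‖ ^ 2 := by
  have h := Complex.Gamma_mul_Gamma_one_sub (t * Complex.I)
  have hne : (t * Complex.I : ℂ) ≠ 0 := by simp [ht.ne']
  have h1 : Complex.Gamma (1 - t * Complex.I) =
      (starRingEnd ℂ) (Complex.Gamma (1 + t * Complex.I)) := by
    rw [← Complex.Gamma_conj]
    congr 1
    simp [sub_eq_add_neg]
  have h2 : Complex.Gamma (1 + t * Complex.I) = t * Complex.I * Complex.Gamma (t * Complex.I) := by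
    rw [add_comm, Complex.Gamma_add_one _ hne]
  have h3 := congrArg norm h
  rw [norm_mul, h1, Complex.norm_conj, norm_div, ← mul_assoc, Complex.sin_mul_I] at h3
  have h4 : ‖Complex.Gamma (1 + t * Complex.I)‖ = t * ‖Complex.Gamma (t * Complex.I)‖ := by
    rw [h2]; simp [abs_of_pos ht]
  have hs : 0 < sinh (π * t) := sinh_pos_iff.2 (by positivity)
  have h5 : ‖Complex.sinh (π * t) * Complex.I‖ = sinh (π * t) := by
    have : (Complex.sinh (π * t)) = ((sinh (π * t) : ℝ) : ℂ) := by push_cast; rfl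
    rw [this, norm_mul, Complex.norm_I, mul_one, Complex.norm_real, norm_eq_abs, abs_of_pos hs]
  rw [h5] at h3
  have h6 : ‖(π : ℂ)‖ = π := by simp [abs_of_pos pi_pos]
  rw [h6] at h3
  have h7 : ‖Complex.Gamma (1 + t * Complex.I)‖ ^ 2 = π * t / sinh (π * t) := by
    calc _ = t * (‖Complex.Gamma (t * Complex.I)‖ * ‖Complex.Gamma (1 + t * Complex.I)‖) := by
          rw [sq]; nth_rw 1 [h4]; ring
      _ = _ := by rw [h3]; ring
  rw [h7, le_div_iff₀ hs, sinh_eq]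
  have : exp (-(π * t)) * exp (π * t) = 1 := by rw [← exp_add]; simp
  have hp : 0 < π * t := by positivity
  have := exp_pos (-(π * t))
  nlinarith [mul_pos hp (mul_pos this this)]

theorem norm_Gamma_one_add_mul_I {t : ℝ} (ht : 1 ≤ t) :
    exp (-(π * t / 2)) ≤ ‖Complex.Gamma (1 + t * Complex.I)‖ := by
  refine le_of_sq_le_sq ?_ (norm_nonneg _)
  refine le_trans ?_ (sq_norm_Gamma_one_add_mul_I (by linarith))
  rw [← exp_nat_mul]
  have : ((2 : ℕ) : ℝ) * -(π * t / 2) = -(π * t) := by push_cast; ring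
  rw [this]
  have h2 : 1 ≤ 2 * π * t := by nlinarith [pi_gt_three]
  nlinarith [exp_pos (-(π * t))]

theorem norm_Gamma_natCast_add (m : ℕ) {t : ℝ} (ht : 1 ≤ t) :
    ‖Complex.Gamma (m + 1 + t * Complex.I)‖ =
      ‖Complex.Gamma (1 + t * Complex.I)‖ * ∏ j ∈ range m, ‖((j : ℂ) + 1 + t * Complex.I)‖ := by
  induction m with
  | zero => simp
  | succ m ih =>
    have hne : ((m : ℂ) + 1 + t * Complex.I) ≠ 0 := by
      intro h
      have := congrArg Complex.im h
      simp at this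
      linarith
    have : (((m + 1 : ℕ) : ℂ) + 1 + t * Complex.I) = (m + 1 + t * Complex.I) + 1 := by
      push_cast; ring
    rw [this, Complex.Gamma_add_one _ hne, norm_mul, ih, prod_range_succ]
    ring

end

/-! ### Two-sided bounds for the Mellin transform at `1 - n i`. -/

section

open Set MeasureTheory

theorem norm_add_natCast_mul_I (n : ℕ) (x : ℝ) :
    ‖(x + n * Complex.I : ℂ)‖ = √((n : ℝ) ^ 2 + x ^ 2) := by
  have := Complex.norm_add_mul_I x n
  rw [Complex.ofReal_natCast] at this
  rw [this, add_comm]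

theorem le_norm_mellin_iteratedDeriv_expNegDiv {R : ℝ} (hR : 0 < R) {n : ℕ} (hn : 2 ≤ n) :
    R * (n ! : ℝ) ^ 2 * (2 / R) ^ n / (4 * Real.exp 1 ^ 2 * n ^ 4) ≤
      ‖mellin (fun y : ℝ => iteratedDeriv n (expNegDiv R) y) (1 - n * Complex.I)‖ := by
  obtain ⟨m, rfl⟩ := Nat.exists_eq_add_of_le' hn
  set n := m + 2 with hndef
  have hn0 : (0 : ℝ) < n := by positivity
  have hn1 : (1 : ℝ) ≤ n := by exact_mod_cast (by omega : 1 ≤ n)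
  have hmn : (n : ℝ) = m + 2 := by simp [hndef]
  have hmn' : (n : ℂ) = m + 2 := by simp [hndef]
  set f : ℕ → ℝ := fun j => √((n : ℝ) ^ 2 + (j : ℝ) ^ 2) with hf
  have hf0 : ∀ j, 0 ≤ f j := fun j => Real.sqrt_nonneg _
  set A := ∏ j ∈ Finset.range n, f j with hA
  have hA0 : 0 ≤ A := Finset.prod_nonneg fun j _ => hf0 j
  set w : ℂ := 1 - n * Complex.I - n with hw
  have hwre : w.re = 1 - n := by simp [hw]
  have h := norm_mellin_iteratedDeriv_expNegDiv hR (w := w) (by rw [hwre, hmn]; linarith) n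
  have hprod : ∏ j ∈ Finset.range n, ‖w + j‖ = A := by
    rw [hA, ← Finset.prod_range_reflect]
    refine Finset.prod_congr rfl fun j hj => ?_
    have hj' : j + 1 ≤ n := Finset.mem_range.1 hj
    have hc : ((n - 1 - j : ℕ) : ℂ) = n - 1 - j := by
      rw [Nat.sub_sub, Nat.cast_sub (by omega)]
      push_cast
      ring
    rw [hf]
    dsimp only
    rw [hc, ← norm_add_natCast_mul_I, ← norm_neg, hw]
    congr 1
    push_cast
    ring
  have hG : ‖Complex.Gamma (-w)‖ =
      ‖Complex.Gamma (1 + n * Complex.I)‖ * ∏ j ∈ Finset.range m, f (j + 1) := by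
    have h1 := norm_Gamma_natCast_add m hn1
    rw [Complex.ofReal_natCast] at h1
    have h2 : -w = m + 1 + n * Complex.I := by rw [hw, hmn']; ring
    rw [h2, h1]
    congr 1
    refine Finset.prod_congr rfl fun j _ => ?_
    have := norm_add_natCast_mul_I n (j + 1)
    push_cast at this
    rw [this]
    simp [hf]
  have hΓ : Real.exp (-(Real.pi * n / 2)) ≤ ‖Complex.Gamma (1 + n * Complex.I)‖ := by
    have := norm_Gamma_one_add_mul_I hn1
    rwa [Complex.ofReal_natCast] at this
  -- The Gamma factor lacks only the indices `0` and `n - 1` of `A`, where `f` is `n` and at most `2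
  -- n`.
  have hB : A ≤ 2 * n ^ 2 * ∏ j ∈ Finset.range m, f (j + 1) := by
    have hfz : f 0 = n := by simp [hf]
    have hfl : f (m + 1) ≤ 2 * n := by
      refine Real.sqrt_le_iff.2 ⟨by positivity, ?_⟩
      push_cast
      nlinarith
    have : A = (∏ j ∈ Finset.range m, f (j + 1)) * f (m + 1) * f 0 := by
      rw [hA, hndef, Finset.prod_range_succ', Finset.prod_range_succ]
    rw [this, hfz]
    have hq : 0 ≤ ∏ j ∈ Finset.range m, f (j + 1) := Finset.prod_nonneg fun j _ => hf0 _
    calc _ ≤ (∏ j ∈ Finset.range m, f (j + 1)) * (2 * n) * n := by gcongr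
      _ = _ := by ring
  have hAsq : (2 * (n : ℝ) ^ 2) ^ n * Real.exp (-2 * n + n * Real.pi / 2) ≤ 2 * A ^ 2 := by
    have := le_prod_sq_add_sq (n := n) (by omega)
    rwa [hA, ← Finset.prod_pow, Finset.prod_congr rfl fun j _ => Real.sq_sqrt (by positivity)]
  have hfac := factorial_le_mul_pow_div_exp (n := n) (by omega)
  have hwn : w + n = 1 - n * Complex.I := by rw [hw]; ring
  rw [hwn, hprod, hG, hwre] at h
  rw [h]
  have hRp : R ^ (1 - (n : ℝ)) = R / R ^ n := by
    rw [Real.rpow_sub hR, Real.rpow_one, Real.rpow_natCast]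
  -- The decay of Gamma exactly cancels the `π` in the growth of the two products, leaving the
  -- exponential of `(n!) ^ 2`.
  have hexp : Real.exp (-2 * n + n * Real.pi / 2) * Real.exp (-(Real.pi * n / 2)) =
      Real.exp (-n) ^ 2 := by
    rw [← Real.exp_add, ← Real.exp_nat_mul]
    congr 1
    push_cast
    ring
  have hBn : A / (2 * n ^ 2) ≤ ∏ j ∈ Finset.range m, f (j + 1) := by
    rw [div_le_iff₀ (by positivity)]
    linarith
  calc R * (n ! : ℝ) ^ 2 * (2 / R) ^ n / (4 * Real.exp 1 ^ 2 * n ^ 4)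
      ≤ R * (Real.exp 1 * n * (n ^ n * Real.exp (-n))) ^ 2 * (2 / R) ^ n /
          (4 * Real.exp 1 ^ 2 * n ^ 4) := by gcongr
    _ = R / R ^ n * ((2 * (n : ℝ) ^ 2) ^ n * Real.exp (-n) ^ 2) / (4 * n ^ 2) := by
        rw [div_pow, mul_pow 2, pow_right_comm _ 2 n]
        field_simp
    _ = R / R ^ n * ((2 * (n : ℝ) ^ 2) ^ n * Real.exp (-2 * n + n * Real.pi / 2)) *
          Real.exp (-(Real.pi * n / 2)) / (4 * n ^ 2) := by rw [← hexp]; ring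
    _ ≤ R / R ^ n * (2 * A ^ 2) * Real.exp (-(Real.pi * n / 2)) / (4 * n ^ 2) := by gcongr
    _ = A * (R / R ^ n * (Real.exp (-(Real.pi * n / 2)) * (A / (2 * n ^ 2)))) := by
        field_simp
        ring
    _ ≤ A * (R / R ^ n * (‖Complex.Gamma (1 + n * Complex.I)‖ *
          ∏ j ∈ Finset.range m, f (j + 1))) := by gcongr
    _ = _ := by rw [hRp]

theorem norm_mellin_iteratedDeriv_expNegDiv_le {R : ℝ} (hR : 0 < R) {n : ℕ} (hn : 2 ≤ n) {M : ℝ}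
    (hM : ∀ x ∈ Ioo 0 R, ‖iteratedDeriv n (expNegDiv R) x‖ ≤ M) :
    ‖mellin (fun y : ℝ => iteratedDeriv n (expNegDiv R) y) (1 - n * Complex.I)‖ ≤
      R * M + n ! * (R * (2 / R) ^ n) := by
  have hc := mellinConvergent_iteratedDeriv_expNegDiv hR n (w := 1 - n * Complex.I)
    (by simp; omega)
  set g : ℝ → ℂ := fun x => (x : ℂ) ^ (1 - n * Complex.I - 1) • iteratedDeriv n (expNegDiv R) x
    with hg
  have hnorm : ∀ x : ℝ, 0 < x → ‖g x‖ = ‖iteratedDeriv n (expNegDiv R) x‖ := by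
    intro x hx
    simp [hg, Complex.norm_cpow_eq_rpow_re_of_pos hx]
  have hint : IntegrableOn g (Ioi 0) := hc
  have hsplit : mellin (fun y : ℝ => iteratedDeriv n (expNegDiv R) y) (1 - n * Complex.I) =
      (∫ x in Ioo 0 R, g x) + ∫ x in Ioi R, g x := by
    rw [mellin, ← integral_Ioc_eq_integral_Ioo, ← setIntegral_union (by simp) measurableSet_Ioi
      (hint.mono_set Ioc_subset_Ioi_self) (hint.mono_set (Ioi_subset_Ioi hR.le)),
      Ioc_union_Ioi_eq_Ioi hR.le]
  rw [hsplit]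
  refine (norm_add_le _ _).trans (add_le_add ?_ ?_)
  · have := norm_setIntegral_le_of_norm_le_const (μ := volume) (s := Ioo 0 R) (f := g) (C := M)
      (by simp) fun x hx => (hnorm x hx.1).trans_le (hM x hx)
    simpa [hR.le, mul_comm] using this
  · have hlt : (-2 : ℝ) < -1 := by norm_num
    -- Cauchy's bound `n! (2 / x) ^ n`: keep `x ^ (-2)` for integrability and replace `x` by `R` in
    -- the other `n - 2` factors.
    have hb := norm_integral_le_of_norm_le (μ := volume.restrict (Ioi R)) (f := g)
      (g := fun x => n ! * (R ^ 2 * (2 / R) ^ n) * x ^ (-2 : ℝ))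
      ((integrableOn_Ioi_rpow_of_lt hlt hR).const_mul _)
      ((ae_restrict_iff' measurableSet_Ioi).2 (.of_forall fun x (hx : R < x) => ?_))
    · refine hb.trans_eq ?_
      rw [integral_const_mul, integral_Ioi_rpow_of_lt hlt hR]
      norm_num
      rw [Real.rpow_neg_one]
      field_simp
    · have hx0 : 0 < x := hR.trans hx
      rw [hnorm x hx0]
      refine (norm_iteratedDeriv_expNegDiv_le hR n 0 hx0).trans ?_
      obtain ⟨m, rfl⟩ := Nat.exists_eq_add_of_le' hn
      have hx2 : x ^ (-2 : ℝ) = 1 / x ^ 2 := by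
        rw [Real.rpow_neg hx0.le, one_div]
        norm_num
      have hpow : (2 / x) ^ m ≤ (2 / R) ^ m := by gcongr
      calc ((m + 2)! : ℝ) * (0 ! * (9 * x / (2 * R)) ^ 0) / (x / 2) ^ (m + 2)
          = (m + 2)! * ((2 / x) ^ m * (4 / x ^ 2)) := by
            simp only [Nat.factorial_zero, Nat.cast_one, pow_zero, mul_one, div_pow, pow_add]
            field_simp
            norm_num
        _ ≤ (m + 2)! * ((2 / R) ^ m * (4 / x ^ 2)) := by gcongr
        _ = _ := by
            rw [hx2, pow_add]
            field_simp
            norm_num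

end

/-! ### The differential equation for `G` and the contradiction. -/

open Set MeasureTheory Filter Topology

theorem borelPhi_of_single {a : ℕ → ℂ} {p : ℕ} {c : ℂ} (hp : 2 ≤ p)
    (ha : ∀ n : ℕ, 2 ≤ n → a n = if n = p then c else 0) (z : ℂ) :
    borelPhi a z = c * z ^ (p - 1) / ((p - 1)! : ℂ) := by
  rw [borelPhi, tsum_eq_single ⟨p, hp⟩]
  · simp [ha p hp]
  · rintro ⟨n, hn⟩ hne
    have : n ≠ p := fun h => hne (Subtype.ext h)
    simp [ha n hn, this]

/-- The lower incomplete Gamma function with a positive integer parameter, `q = p - 1`. -/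
noncomputable def lowerGamma (q : ℕ) (y : ℝ) : ℝ := ∫ u in (0 : ℝ)..y, u ^ q * Real.exp (-u)

theorem hasDerivAt_lowerGamma (q : ℕ) (y : ℝ) :
    HasDerivAt (lowerGamma q) (y ^ q * Real.exp (-y)) y := by
  have hc : Continuous fun u : ℝ => u ^ q * Real.exp (-u) := by fun_prop
  exact intervalIntegral.integral_hasDerivAt_right (hc.intervalIntegrable _ _)
    hc.aestronglyMeasurable.stronglyMeasurableAtFilter hc.continuousAt

theorem contDiff_lowerGamma (q : ℕ) : ContDiff ℝ (⊤ : ℕ∞) (lowerGamma q) := by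
  refine contDiff_infty_iff_deriv.2
    ⟨fun y => (hasDerivAt_lowerGamma q y).differentiableAt, ?_⟩
  have : deriv (lowerGamma q) = fun y => y ^ q * Real.exp (-y) :=
    funext fun y => (hasDerivAt_lowerGamma q y).deriv
  rw [this]
  fun_prop

theorem truncLaplace_of_single {a : ℕ → ℂ} {p : ℕ} {c : ℂ} (hp : 2 ≤ p)
    (ha : ∀ n : ℕ, 2 ≤ n → a n = if n = p then c else 0) (R : ℝ) {x : ℝ} (hx : 0 < x) :
    truncLaplace a R x =
      c / ((p - 1)! : ℂ) * ((x ^ p * lowerGamma (p - 1) (R / x) : ℝ) : ℂ) := by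
  have h1 : ∀ t : ℝ, borelPhi a (t : ℂ) * (Real.exp (-t / x) : ℂ) =
      c / ((p - 1)! : ℂ) * ((t ^ (p - 1) * Real.exp (-t / x) : ℝ) : ℂ) := by
    intro t
    rw [borelPhi_of_single hp ha]
    push_cast
    ring
  simp only [truncLaplace, h1]
  rw [intervalIntegral.integral_const_mul, intervalIntegral.integral_ofReal]
  congr 2
  have h2 := intervalIntegral.integral_comp_div (a := 0) (b := R)
    (fun u : ℝ => u ^ (p - 1) * Real.exp (-u)) hx.ne'
  rw [zero_div] at h2
  have h3 : ∀ t : ℝ, t ^ (p - 1) * Real.exp (-t / x) =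
      x ^ (p - 1) * ((t / x) ^ (p - 1) * Real.exp (-(t / x))) := by
    intro t
    rw [div_pow, neg_div]
    field_simp
  simp only [h3]
  rw [intervalIntegral.integral_const_mul, h2, smul_eq_mul, ← mul_assoc, ← pow_succ,
    Nat.sub_add_cancel (by omega), lowerGamma]

theorem contDiffAt_truncLaplace {a : ℕ → ℂ} {p : ℕ} {c : ℂ} (hp : 2 ≤ p)
    (ha : ∀ n : ℕ, 2 ≤ n → a n = if n = p then c else 0) (R : ℝ) {x : ℝ} (hx : 0 < x) :
    ContDiffAt ℝ (⊤ : ℕ∞) (truncLaplace a R) x := by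
  have h : ContDiffAt ℝ (⊤ : ℕ∞) (fun y : ℝ => y ^ p * lowerGamma (p - 1) (R / y)) x :=
    (contDiffAt_id.pow p).mul
      ((contDiff_lowerGamma (p - 1)).contDiffAt.comp x (contDiffAt_const.div contDiffAt_id hx.ne'))
  have h' := contDiffAt_const (c := c / ((p - 1)! : ℂ)) |>.mul
    (Complex.ofRealCLM.contDiff.contDiffAt.comp x h)
  refine h'.congr_of_eventuallyEq ?_
  filter_upwards [lt_mem_nhds hx] with y hy
  exact truncLaplace_of_single hp ha R hy

theorem hasDerivAt_iteratedDeriv_truncLaplace {a : ℕ → ℂ} {p : ℕ} {c : ℂ} (hp : 2 ≤ p)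
    (ha : ∀ n : ℕ, 2 ≤ n → a n = if n = p then c else 0) (R : ℝ) (n : ℕ) {x : ℝ} (hx : 0 < x) :
    HasDerivAt (iteratedDeriv n (truncLaplace a R)) (iteratedDeriv (n + 1) (truncLaplace a R) x)
      x := by
  rw [iteratedDeriv_succ]
  refine DifferentiableAt.hasDerivAt ?_
  have h := (contDiffAt_truncLaplace hp ha R hx).of_le
    (m := ((n + 1 : ℕ) : ℕ∞)) (by exact_mod_cast le_top)
  have hd := h.contDiffWithinAt (s := univ) |>.differentiableWithinAt_iteratedDerivWithin
    (m := n) (by exact_mod_cast Nat.lt_succ_self n) (by simp)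
  rw [iteratedDerivWithin_univ] at hd
  exact differentiableWithinAt_univ.1 hd

theorem mul_iteratedDeriv_succ_truncLaplace {a : ℕ → ℂ} {p : ℕ} {c : ℂ} (hp : 2 ≤ p)
    (ha : ∀ n : ℕ, 2 ≤ n → a n = if n = p then c else 0) (R : ℝ) (n : ℕ) {x : ℝ} (hx : 0 < x) :
    x * iteratedDeriv (n + 1) (truncLaplace a R) x + (n - p) * iteratedDeriv n (truncLaplace a R) x
      = -(c * R ^ p / ((p - 1)! : ℂ)) * iteratedDeriv n (expNegDiv R) x := by
  induction n generalizing x with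
  | zero =>
    have hd : HasDerivAt (fun y : ℝ => y ^ p * lowerGamma (p - 1) (R / y))
        (p * x ^ (p - 1) * lowerGamma (p - 1) (R / x) +
          x ^ p * ((R / x) ^ (p - 1) * Real.exp (-(R / x)) * (-R / x ^ 2))) x := by
      refine (hasDerivAt_pow p x).mul ((hasDerivAt_lowerGamma (p - 1) (R / x)).comp x ?_)
      have h := (hasDerivAt_inv hx.ne').const_mul R
      simp only [← div_eq_mul_inv] at h
      exact h.congr_deriv (by rw [mul_neg, ← div_eq_mul_inv, neg_div])
    have hd' := (hd.ofReal_comp).const_mul (c / ((p - 1)! : ℂ))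
    have hev : truncLaplace a R =ᶠ[𝓝 x] fun y : ℝ => c / ((p - 1)! : ℂ) *
        ((y ^ p * lowerGamma (p - 1) (R / y) : ℝ) : ℂ) := by
      filter_upwards [lt_mem_nhds hx] with y hy
      exact truncLaplace_of_single hp ha R hy
    rw [iteratedDeriv_one, iteratedDeriv_zero, iteratedDeriv_zero,
      (hd'.congr_of_eventuallyEq hev).deriv, truncLaplace_of_single hp ha R hx, expNegDiv]
    obtain ⟨q, rfl⟩ := Nat.exists_eq_add_of_le' (show 1 ≤ p by omega)
    have hx0 : (x : ℂ) ≠ 0 := by exact_mod_cast hx.ne'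
    have hq : ((q + 1 - 1)! : ℂ) ≠ 0 := by exact_mod_cast Nat.factorial_ne_zero _
    rw [← neg_div]
    simp only [Nat.add_sub_cancel] at hq ⊢
    push_cast
    rw [div_pow]
    field_simp
    ring
  | succ n ih =>
    have h1 := ((hasDerivAt_id (x : ℂ)).comp_ofReal.mul
      (hasDerivAt_iteratedDeriv_truncLaplace hp ha R (n + 1) hx)).add
        ((hasDerivAt_iteratedDeriv_truncLaplace hp ha R n hx).const_mul ((n : ℂ) - p))
    have h2 := (hasDerivAt_iteratedDeriv_expNegDiv R n hx).const_mul
      (-(c * R ^ p / ((p - 1)! : ℂ)))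
    have h3 := h2.congr_of_eventuallyEq (f₁ := _) (by
      filter_upwards [lt_mem_nhds hx] with y hy
      exact ih hy)
    -- The identity of order `n` holds near `x`, so both sides have the same derivative there.
    have h4 := h1.unique h3
    simp only [id] at h4
    rw [← h4]
    push_cast
    ring

/-- In the differentiated equation, `x < S` absorbs one `1 / S` of the order `n + 1` bound, leaving
`2 (n + 1) ^ 2 ≤ 8 n ^ 2`; the other coefficient satisfies `|n - p| ≤ (1 + p) n ^ 2`. -/
theorem norm_iteratedDeriv_expNegDiv_le_of_truncLaplace {a : ℕ → ℂ} {p : ℕ} {c : ℂ} (hp : 2 ≤ p)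
    (ha : ∀ n : ℕ, 2 ≤ n → a n = if n = p then c else 0) {R : ℝ} (hR : 0 < R) {K S : ℝ}
    (hK : 0 < K) (hS : R < S)
    (h : ∀ n : ℕ, ∀ x ∈ Ioo (0 : ℝ) R,
      ‖iteratedDeriv n (truncLaplace a R) x‖ ≤ K * (n ! : ℝ) ^ 2 * (2 / S) ^ n)
    {n : ℕ} (hn : 1 ≤ n) {x : ℝ} (hx : x ∈ Ioo 0 R) :
    ‖c * R ^ p / ((p - 1)! : ℂ)‖ * ‖iteratedDeriv n (expNegDiv R) x‖ ≤
      (9 + p) * n ^ 2 * (K * (n ! : ℝ) ^ 2 * (2 / S) ^ n) := by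
  have hS0 : 0 < S := hR.trans hS
  have hn' : (1 : ℝ) ≤ n := by exact_mod_cast hn
  rw [← norm_mul, ← norm_neg, ← neg_mul, ← mul_iteratedDeriv_succ_truncLaplace hp ha R n hx.1]
  set D := K * (n ! : ℝ) ^ 2 * (2 / S) ^ n with hD
  have hD0 : 0 ≤ D := by positivity
  have h1 : ‖(x : ℂ) * iteratedDeriv (n + 1) (truncLaplace a R) x‖ ≤ 8 * n ^ 2 * D := by
    rw [norm_mul, Complex.norm_real, Real.norm_eq_abs, abs_of_pos hx.1]
    calc x * ‖iteratedDeriv (n + 1) (truncLaplace a R) x‖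
        ≤ S * (K * ((n + 1)! : ℝ) ^ 2 * (2 / S) ^ (n + 1)) :=
          mul_le_mul (hx.2.trans hS).le (h _ x hx) (norm_nonneg _) hS0.le
      _ = 2 * (n + 1) ^ 2 * D := by
          rw [hD, Nat.factorial_succ, pow_succ (2 / S)]
          push_cast
          field_simp
      _ ≤ 8 * n ^ 2 * D := by
          refine mul_le_mul_of_nonneg_right ?_ hD0
          nlinarith
  have h2 : ‖((n : ℂ) - p) * iteratedDeriv n (truncLaplace a R) x‖ ≤ (1 + p) * n ^ 2 * D := by
    rw [norm_mul]
    have : ‖((n : ℂ) - p)‖ ≤ (1 + p) * n ^ 2 := by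
      refine (norm_sub_le _ _).trans ?_
      rw [Complex.norm_natCast, Complex.norm_natCast]
      have : (1 : ℝ) ≤ n ^ 2 := one_le_pow₀ hn'
      have hp0 : (0 : ℝ) ≤ p := by positivity
      nlinarith
    exact mul_le_mul this (h n x hx) (norm_nonneg _) (by positivity)
  refine (norm_add_le _ _).trans ((add_le_add h1 h2).trans_eq ?_)
  ring

theorem tendsto_pow_mul_pow_add_pow_div_factorial (B : ℝ) {r : ℝ} (hr0 : 0 ≤ r) (hr : r < 1) :
    Tendsto (fun n : ℕ => B * ((n : ℝ) ^ 6 * r ^ n) + (n : ℝ) ^ 4 / n !) atTop (𝓝 0) := by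
  have h1 := (tendsto_pow_const_mul_const_pow_of_abs_lt_one 6
    (abs_lt.2 ⟨by linarith, hr⟩)).const_mul B
  have h2 := (tendsto_pow_const_mul_const_pow_of_abs_lt_one 4
    (r := 1 / 2) (abs_lt.2 ⟨by norm_num, by norm_num⟩)).mul
      (FloorSemiring.tendsto_pow_div_factorial_atTop (2 : ℝ))
  have h3 := h1.add h2
  rw [mul_zero, mul_zero, add_zero] at h3
  refine h3.congr fun n => ?_
  rw [one_div, inv_pow]
  field_simp

theorem theorem4p2 (R₀ R : ℝ) (hR : 0 < R) (hR₀ : R < R₀) (p : ℕ) (hp : 2 ≤ p)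
    (C : ℝ) (hC : C ≠ 0) (a : ℕ → ℂ)
    (ha : ∀ n : ℕ, 2 ≤ n → a n = if n = p then (C : ℂ) * (p ! : ℂ) / (R : ℂ) ^ p else 0) :
    ¬ ∃ Chat Rhat : ℝ, 0 < Chat ∧ R < Rhat ∧
      ∀ n : ℕ, ∀ x ∈ Set.Ioo (0 : ℝ) R,
        ‖iteratedDeriv n (truncLaplace a R) x‖ ≤ Chat * (n ! : ℝ) ^ 2 * (2 / Rhat) ^ n := by
  rintro ⟨K, S, hK, hS, h⟩
  have hS0 : 0 < S := hR.trans hS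
  set d : ℝ := ‖(C : ℂ) * (p ! : ℂ) / (R : ℂ) ^ p * R ^ p / ((p - 1)! : ℂ)‖ with hd
  have hd0 : 0 < d := by
    have : (R : ℂ) ≠ 0 := by exact_mod_cast hR.ne'
    have : (C : ℂ) ≠ 0 := by exact_mod_cast hC
    have := Nat.factorial_ne_zero p
    have := Nat.factorial_ne_zero (p - 1)
    rw [hd, norm_pos_iff]
    simp_all
  set B : ℝ := (9 + p) * K / d with hB
  have hlim := tendsto_pow_mul_pow_add_pow_div_factorial B (r := R / S) (by positivity)
    ((div_lt_one hS0).2 hS)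
  have hpos : 0 < 1 / (4 * Real.exp 1 ^ 2) := by positivity
  obtain ⟨n, hlt, hn⟩ := ((hlim.eventually_lt_const hpos).and (eventually_ge_atTop 2)).exists
  have hn0 : (0 : ℝ) < n := by exact_mod_cast (by omega : 0 < n)
  have hM : ∀ x ∈ Ioo 0 R, ‖iteratedDeriv n (expNegDiv R) x‖ ≤
      B * n ^ 2 * (n ! : ℝ) ^ 2 * (2 / S) ^ n := by
    intro x hx
    have := norm_iteratedDeriv_expNegDiv_le_of_truncLaplace hp ha hR hK hS h (by omega : 1 ≤ n) hx
    rw [← hd, mul_comm, ← le_div_iff₀ hd0] at this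
    refine this.trans_eq ?_
    rw [hB]
    ring
  have key := (le_norm_mellin_iteratedDeriv_expNegDiv hR hn).trans
    (norm_mellin_iteratedDeriv_expNegDiv_le hR hn hM)
  -- Dividing both Mellin bounds by this quantity leaves a fixed positive constant below a null
  -- sequence.
  have hT : 0 < R * (n ! : ℝ) ^ 2 * (2 / R) ^ n / n ^ 4 := by positivity
  have h1 : R * (n ! : ℝ) ^ 2 * (2 / R) ^ n / (4 * Real.exp 1 ^ 2 * n ^ 4) =
      R * (n ! : ℝ) ^ 2 * (2 / R) ^ n / n ^ 4 * (1 / (4 * Real.exp 1 ^ 2)) := by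
    field_simp
  have h2 : R * (B * n ^ 2 * (n ! : ℝ) ^ 2 * (2 / S) ^ n) + n ! * (R * (2 / R) ^ n) =
      R * (n ! : ℝ) ^ 2 * (2 / R) ^ n / n ^ 4 *
        (B * ((n : ℝ) ^ 6 * (R / S) ^ n) + (n : ℝ) ^ 4 / n !) := by
    simp only [div_pow]
    field_simp
  rw [h1, h2] at key
  exact absurd (le_of_mul_le_mul_left key hT) (not_le.2 hlt)
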